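/- Let $m$ be Lebesgue measure on $[0,1]$, $L^1=L^1([0,1],m)$ (real or complex scalars), and let $\Lambda=(\lambda_n)_{n\ge 1}$ be any strictly increasing sequence of positive real numbers with $\sum_{n\ge 1} 1/\lambda_n<\infty$. The Müntz space $M^1_\Lambda$ is the closed linear span in $L^1$ of the monomials $x^{\lambda_n}$, $n\ge 1$. Let $\varphi:[0,1]\to[0,1]$ be a $C^1$ function (with one-sided derivatives at the end points), and let $C_\varphi f=f\circ\varphi$. Here each $f\in M^1_\Lambda$ is evaluated through its representative that is continuous on $[0,1)$; at $1$ it is given the value $\lim_{x\to1^-}f(x)$ if this limit exists (so finite linear combinations of the monomials keep their usual value there), and an arbitrary value otherwise. Then $C_\varphi$ is (well defined and) bounded from $M^1_\Lambda$ to $L^1$ if and only if one of the following holds: 1. $\varphi([0,1])\subset[0,1)$; 2. $\varphi^{-1}(\{1\})\subset\{0,1\}$, and $\varphi'(x_0)\neq 0$ for every $x_0\in[0,1]$ with $\varphi(x_0)=1$. -/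

import Mathlib

open MeasureTheory Set Filter Topology

/-- Lebesgue measure on the interval `[0,1]`. -/
noncomputable def unitMeasure : Measure ℝ := volume.restrict (Icc (0 : ℝ) 1)

/-- The Müntz space `M¹_Λ`: the closed linear span in `L¹([0,1])` of the (classes of the) monomials
`x ^ Λ n`. -/
noncomputable def muntzSpace (𝕜 : Type*) [RCLike 𝕜] (Λ : ℕ → ℝ) :
    Submodule 𝕜 (Lp 𝕜 1 unitMeasure) :=
  (Submodule.span 𝕜 {f : Lp 𝕜 1 unitMeasure |
    ∃ n, ⇑f =ᵐ[unitMeasure] fun x => ((x ^ Λ n : ℝ) : 𝕜)}).topologicalClosure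

/-- `g` is the continuous function on `[0,1)` representing the class `f`; it is also continuous at
`1` whenever it has a left limit there (so that Müntz polynomials keep their value at `1`). -/
structure IsContRepr {𝕜 : Type*} [RCLike 𝕜] (g : ℝ → 𝕜) (f : Lp 𝕜 1 unitMeasure) : Prop where
  ae_eq : g =ᵐ[unitMeasure] f
  continuousOn : ContinuousOn g (Ico 0 1)
  eq_of_tendsto : ∀ l : 𝕜, Tendsto g (𝓝[<] 1) (𝓝 l) → g 1 = l

/-- The composition operator `C_φ f = f ∘ φ` is a (well-defined) bounded linear operator from
`M¹_Λ` to `L¹([0,1])`. The elements of `M¹_Λ` are evaluated through their continuous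
representatives. -/
def CompositionBounded (𝕜 : Type*) [RCLike 𝕜] (Λ : ℕ → ℝ) (φ : ℝ → ℝ) : Prop :=
  ∃ T : muntzSpace 𝕜 Λ →L[𝕜] Lp 𝕜 1 unitMeasure, ∀ f : muntzSpace 𝕜 Λ,
    ∃ g : ℝ → 𝕜, IsContRepr g (f : Lp 𝕜 1 unitMeasure) ∧ ⇑(T f) =ᵐ[unitMeasure] g ∘ φ

/-! Sufficiency rests on one estimate: for r < 1, `‖P x‖` on [0,r] is at most a constant times the
`L¹` norm of P, uniformly over Müntz polynomials P. Hence elements of the Müntz space are continuous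
on [0,1), and `f ∘ φ` is controlled wherever φ stays below 1. Near a point where φ = 1 and φ' ≠ 0, a
change of variables bounds its integral; compactness of [0,1] glues the local bounds
(`compositionBounded_of_forall`).

The substitution x = e^{-s} turns P into an exponential sum on (0,∞), integrated against e^{-s} ds.
A combination of shifts, I - ∑ c_k τ_{d_k h}, kills a block of exponents, leaving a shorter sum
already under control. If ∑ |c_k| is small, the subtracted shifts can be absorbed
(`norm_expSum_le_of_annihilator`). Each block costs a margin in s; over dyadic blocks the margins
are comparable to 2^j/Λ(2^j), plus a geometric term, so their sum converges by Cauchy condensation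
(`exists_norm_expSum_le`).

Necessity is tested on one monomial x^l with l large. If φ touches 1 with zero derivative, φ^l
exceeds 1/2 on an interval too long for its norm 1/(l+1). An interior point where φ = 1 is a
maximum, so its derivative does vanish. -/

/-! ### Interpolation of a power with small coefficients -/

/-- Modulo `∏ (X - w i)` with `N` small nodes, `X ^ m` is a polynomial with small coefficients. -/
theorem exists_pow_reduction (w : ℕ → ℝ) (N : ℕ) (hw : ∀ i < N, 0 ≤ w i ∧ w i ≤ 1 / 2) :
    ∀ m : ℕ, ∃ c : ℕ → ℝ, (∀ k, N ≤ k → c k = 0) ∧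
      (∀ i < N, ∑ k ∈ Finset.range N, c k * w i ^ k = w i ^ m) ∧
      ∑ k ∈ Finset.range N, |c k| ≤ 7 ^ N * (3 / 4) ^ m := by
  induction N with
  | zero => exact fun m => ⟨0, by simp, by simp, by simp; positivity⟩
  | succ N ih =>
    intro m
    choose C hC0 hCe hCn using ih fun i hi => hw i (by omega)
    obtain ⟨hv0, hv1⟩ := hw N (by omega)
    set v := w N with hv
    -- Coefficients of (X^m - v^m)/(X - v) = ∑ X^j v^(m-1-j), after each X^j is replaced by its
    -- reduction at the first N nodes.
    set S : ℕ → ℝ := fun k => ∑ j ∈ Finset.range m, C j k * v ^ (m - 1 - j) with hS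
    have hSN : S N = 0 := Finset.sum_eq_zero fun j _ => by rw [hC0 j N le_rfl, zero_mul]
    have hSn : ∑ k ∈ Finset.range N, |S k| ≤ 7 ^ N * (4 * (3 / 4) ^ m) := by
      calc ∑ k ∈ Finset.range N, |S k|
          ≤ ∑ k ∈ Finset.range N, ∑ j ∈ Finset.range m, |C j k| * (1 / 2) ^ (m - 1 - j) := by
            refine Finset.sum_le_sum fun k _ => (Finset.abs_sum_le_sum_abs _ _).trans
              (Finset.sum_le_sum fun j _ => ?_)
            rw [abs_mul, abs_of_nonneg (pow_nonneg hv0 _)]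
            gcongr
        _ = ∑ j ∈ Finset.range m, (∑ k ∈ Finset.range N, |C j k|) * (1 / 2) ^ (m - 1 - j) := by
            rw [Finset.sum_comm]
            simp_rw [Finset.sum_mul]
        _ ≤ ∑ j ∈ Finset.range m, (7 ^ N * (3 / 4) ^ j) * (1 / 2) ^ (m - 1 - j) := by
            gcongr with j _
            exact hCn j
        _ = 7 ^ N * ∑ j ∈ Finset.range m, (3 / 4 : ℝ) ^ j * (1 / 2) ^ (m - 1 - j) := by
            rw [Finset.mul_sum]
            exact Finset.sum_congr rfl fun j _ => by ring
        _ ≤ 7 ^ N * (4 * (3 / 4) ^ m) := by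
            gcongr
            have := geom_sum₂_mul (3 / 4 : ℝ) (1 / 2) m
            have h2 : (0 : ℝ) ≤ (1 / 2) ^ m := by positivity
            linarith
    -- The new interpolant is v^m + (X - v) S: it is right at v for any S, and at the old nodes by
    -- the choice of S.
    refine ⟨fun k => k.casesOn (v ^ m - v * S 0) fun k => S k - v * S (k + 1), ?_, ?_, ?_⟩
    · rintro (_ | k) hk
      · omega
      · have h0 : ∀ l, N ≤ l → S l = 0 := fun l hl =>
          Finset.sum_eq_zero fun j _ => by rw [hC0 j l hl, zero_mul]
        simp [h0 k (by omega), h0 (k + 1) (by omega)]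
    · intro i hi
      have key : ∀ x : ℝ, ∑ k ∈ Finset.range N, S k * x ^ k =
          ∑ k ∈ Finset.range N, S (k + 1) * x ^ (k + 1) + S 0 := by
        intro x
        have := Finset.sum_range_succ' (fun k => S k * x ^ k) N
        rw [Finset.sum_range_succ, hSN] at this
        simpa using this
      rw [Finset.sum_range_succ']
      have e : ∑ k ∈ Finset.range N, (S k - v * S (k + 1)) * w i ^ (k + 1) + (v ^ m - v * S 0)
          = v ^ m + (w i - v) * ∑ k ∈ Finset.range N, S k * w i ^ k := by
        have a1 : ∑ k ∈ Finset.range N, S k * w i ^ (k + 1) =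
          ∑ k ∈ Finset.range N, w i * (S k * w i ^ k) := Finset.sum_congr rfl fun k _ => by ring
        have a2 : ∑ k ∈ Finset.range N, v * S (k + 1) * w i ^ (k + 1) =
          ∑ k ∈ Finset.range N, v * (S (k + 1) * w i ^ (k + 1)) :=
          Finset.sum_congr rfl fun k _ => by ring
        simp only [sub_mul, Finset.sum_sub_distrib] at a1 a2 ⊢
        rw [a1, a2, ← Finset.mul_sum, ← Finset.mul_sum]
        linear_combination v * key (w i)
      simp only [pow_zero, mul_one]
      refine e.trans ?_
      rcases Nat.lt_succ_iff_lt_or_eq.mp hi with hi | rfl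
      · have : ∑ k ∈ Finset.range N, S k * w i ^ k =
            ∑ j ∈ Finset.range m, w i ^ j * v ^ (m - 1 - j) := by
          simp_rw [hS, Finset.sum_mul]
          rw [Finset.sum_comm]
          refine Finset.sum_congr rfl fun j _ => ?_
          rw [← hCe j i hi, Finset.sum_mul]
          exact Finset.sum_congr rfl fun k _ => by ring
        rw [this, mul_comm, geom_sum₂_mul]
        ring
      · simp [hv]
    · rw [Finset.sum_range_succ']
      have h1 : ∑ k ∈ Finset.range N, |S k - v * S (k + 1)| ≤
          ∑ k ∈ Finset.range N, |S k| + v * ∑ k ∈ Finset.range N, |S (k + 1)| := by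
        rw [Finset.mul_sum, ← Finset.sum_add_distrib]
        refine Finset.sum_le_sum fun k _ => (abs_sub _ _).trans ?_
        rw [abs_mul, abs_of_nonneg hv0]
      have h2 : |v ^ m - v * S 0| ≤ v ^ m + v * |S 0| := by
        refine (abs_sub _ _).trans ?_
        rw [abs_mul, abs_of_nonneg hv0, abs_of_nonneg (pow_nonneg hv0 _)]
      have h3 : ∑ k ∈ Finset.range N, |S (k + 1)| + |S 0| = ∑ k ∈ Finset.range N, |S k| := by
        have := Finset.sum_range_succ' (fun k => |S k|) N
        rw [Finset.sum_range_succ, hSN] at this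
        simpa using this.symm
      have h4 : v ^ m ≤ (3 / 4) ^ m := by gcongr; linarith
      have h5 : v * ∑ k ∈ Finset.range N, |S k| ≤ 1 / 2 * (7 ^ N * (4 * (3 / 4) ^ m)) := by
        gcongr
      have h6 : (3 / 4 : ℝ) ^ m ≤ 7 ^ N * (3 / 4) ^ m :=
        le_mul_of_one_le_left (by positivity) (one_le_pow₀ (by norm_num))
      have h7 : v * ∑ k ∈ Finset.range N, |S k| =
          v * ∑ k ∈ Finset.range N, |S (k + 1)| + v * |S 0| := by rw [← h3]; ring
      calc _ ≤ _ := add_le_add h1 h2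
        -- The base 7 is 1 + (1 + 1/2) · 4: v^m contributes 1, and (X - v) S at most 3/2 times the
        -- bound 4 from the geometric sum.
        _ ≤ (7 : ℝ) ^ (N + 1) * (3 / 4) ^ m := by
          rw [pow_succ]; linarith

/-! ### Exponential sums and annihilation by shifts -/

section ExpSum

variable {E : Type*} [NormedAddCommGroup E] [NormedSpace ℝ E]

/-- The exponential sum `∑_{k < n} e^{-Λ k s} a k`. -/
noncomputable def expSum (Λ : ℕ → ℝ) (n : ℕ) (a : ℕ → E) (s : ℝ) : E :=
  ∑ k ∈ Finset.range n, Real.exp (-(Λ k * s)) • a k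

/-- The integral of `‖f‖` over `(β, ∞)` against `e^{-s} ds`. -/
noncomputable def expWeightedIntegral (β : ℝ) (f : ℝ → E) : ℝ :=
  ∫ s in Ioi β, Real.exp (-s) * ‖f s‖

theorem continuous_expSum (Λ : ℕ → ℝ) (n : ℕ) (a : ℕ → E) : Continuous (expSum Λ n a) := by
  unfold expSum
  fun_prop

theorem norm_expSum_le {Λ : ℕ → ℝ} (hΛ : ∀ k, 0 < Λ k) (n : ℕ) (a : ℕ → E) {s : ℝ} (hs : 0 ≤ s) :
    ‖expSum Λ n a s‖ ≤ ∑ k ∈ Finset.range n, ‖a k‖ := by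
  refine (norm_sum_le _ _).trans (Finset.sum_le_sum fun k _ => ?_)
  rw [norm_smul, Real.norm_eq_abs, Real.abs_exp]
  refine mul_le_of_le_one_left (norm_nonneg _) (Real.exp_le_one_iff.2 ?_)
  have := mul_nonneg (hΛ k).le hs
  linarith

theorem expSum_sub (Λ : ℕ → ℝ) (n : ℕ) (a : ℕ → E) (s δ : ℝ) :
    expSum Λ n a (s - δ) = expSum Λ n (fun k => Real.exp (Λ k * δ) • a k) s := by
  refine Finset.sum_congr rfl fun k _ => ?_
  rw [smul_smul, ← Real.exp_add]
  congr 2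
  ring

theorem integrableOn_expSum {Λ : ℕ → ℝ} (hΛ : ∀ k, 0 < Λ k) (n : ℕ) (a : ℕ → E) (β : ℝ) :
    IntegrableOn (fun s => Real.exp (-s) * ‖expSum Λ n a s‖) (Ioi β) := by
  have h : IntegrableOn
      (fun s => ∑ k ∈ Finset.range n, Real.exp (-(1 + Λ k) * s) • a k) (Ioi β) :=
    integrable_finsetSum _ fun k _ =>
      (exp_neg_integrableOn_Ioi β (by linarith [hΛ k])).smul_const (a k)
  refine h.norm.congr (ae_of_all _ fun s => ?_)
  have : ∑ k ∈ Finset.range n, Real.exp (-(1 + Λ k) * s) • a k =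
      Real.exp (-s) • expSum Λ n a s := by
    rw [expSum, Finset.smul_sum]
    refine Finset.sum_congr rfl fun k _ => ?_
    rw [smul_smul, ← Real.exp_add]
    congr 2
    ring
  simp only [this, norm_smul, Real.norm_eq_abs, Real.abs_exp]

omit [NormedSpace ℝ E] in
theorem expWeightedIntegral_nonneg (β : ℝ) (f : ℝ → E) : 0 ≤ expWeightedIntegral β f :=
  setIntegral_nonneg measurableSet_Ioi fun _ _ => by positivity

theorem expWeightedIntegral_anti {Λ : ℕ → ℝ} (hΛ : ∀ k, 0 < Λ k) (n : ℕ) (a : ℕ → E) {β γ : ℝ}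
    (h : γ ≤ β) :
    expWeightedIntegral β (expSum Λ n a) ≤ expWeightedIntegral γ (expSum Λ n a) :=
  setIntegral_mono_set (integrableOn_expSum hΛ n a γ) (ae_of_all _ fun _ => by positivity)
    (Ioi_subset_Ioi h).eventuallyLE

theorem expWeightedIntegral_shift_le {Λ : ℕ → ℝ} (hΛ : ∀ k, 0 < Λ k) (n : ℕ) (a : ℕ → E)
    {β γ δ : ℝ} (hδ : 0 ≤ δ) (h : γ ≤ β - δ) :
    expWeightedIntegral β (fun s => expSum Λ n a (s - δ)) ≤
      expWeightedIntegral γ (expSum Λ n a) := by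
  have e : expWeightedIntegral β (fun s => expSum Λ n a (s - δ)) =
      Real.exp (-δ) * expWeightedIntegral (β - δ) (expSum Λ n a) := by
    unfold expWeightedIntegral
    rw [← integral_const_mul]
    have := (measurePreserving_sub_right volume δ).setIntegral_preimage_emb
      (MeasurableEquiv.subRight δ).measurableEmbedding
      (fun s => Real.exp (-δ) * (Real.exp (-s) * ‖expSum Λ n a s‖)) (Ioi (β - δ))
    rw [← this]
    have hp : (fun x => x - δ) ⁻¹' Ioi (β - δ) = Ioi β := by ext x; simp
    rw [hp]
    refine setIntegral_congr_fun measurableSet_Ioi fun s _ => ?_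
    simp only
    rw [← mul_assoc, ← Real.exp_add]
    congr 2
    ring
  rw [e]
  refine (mul_le_of_le_one_left (expWeightedIntegral_nonneg _ _)
    (Real.exp_le_one_iff.2 (by linarith))).trans (expWeightedIntegral_anti hΛ n a h)

/-- The average of `‖f (y - d h)‖` over `h ∈ [h₀, 2 h₀]`. -/
theorem integral_norm_expSum_shift_le {Λ : ℕ → ℝ} (hΛ : ∀ k, 0 < Λ k) (n : ℕ) (a : ℕ → E)
    {γ y d h₀ : ℝ} (hd : 1 ≤ d) (hh : 0 < h₀) (hy : γ ≤ y - 2 * d * h₀) :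
    ∫ h in h₀..2 * h₀, ‖expSum Λ n a (y - d * h)‖ ≤
      Real.exp y * expWeightedIntegral γ (expSum Λ n a) := by
  have hd0 : d ≠ 0 := by positivity
  have hle : y - d * (2 * h₀) ≤ y - d * h₀ := by nlinarith
  rw [intervalIntegral.integral_comp_sub_mul (fun s => ‖expSum Λ n a s‖) hd0, smul_eq_mul]
  have h0 : 0 ≤ ∫ s in y - d * (2 * h₀)..y - d * h₀, ‖expSum Λ n a s‖ :=
    intervalIntegral.integral_nonneg hle fun _ _ => norm_nonneg _
  refine (mul_le_of_le_one_left h0 (inv_le_one_of_one_le₀ hd)).trans ?_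
  rw [intervalIntegral.integral_of_le hle, expWeightedIntegral, ← integral_const_mul]
  have hc := continuous_expSum Λ n a
  calc ∫ s in Ioc (y - d * (2 * h₀)) (y - d * h₀), ‖expSum Λ n a s‖
      ≤ ∫ s in Ioc (y - d * (2 * h₀)) (y - d * h₀),
          Real.exp y * (Real.exp (-s) * ‖expSum Λ n a s‖) := by
        refine setIntegral_mono_on (hc.norm.integrableOn_Ioc)
          (Continuous.integrableOn_Ioc (by fun_prop)) measurableSet_Ioc fun s hs => ?_
        rw [← mul_assoc, ← Real.exp_add]
        refine le_mul_of_one_le_left (norm_nonneg _) (Real.one_le_exp ?_)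
        have := hs.2
        nlinarith
    _ ≤ _ := setIntegral_mono_set ((integrableOn_expSum hΛ n a γ).const_mul _)
        (ae_of_all _ fun _ => by positivity)
        (LE.le.eventuallyLE fun s hs => by
          have := hs.1
          simp only [mem_Ioi]
          linarith)

/-- Write P = TP + ∑ c_k P(· - d_k h), where T kills the exponents with n' ≤ j < n, so that `hlow`
applies to TP. Far from y₀ the shifted points stay beyond y₀ and contribute at most ε sup ‖P‖; near
y₀, averaging over h replaces point values by the weighted integral. Since ε < 1, the supremum is
absorbed. -/
theorem norm_expSum_le_of_annihilator {Λ : ℕ → ℝ} (hΛ : ∀ k, 0 < Λ k) {n' n : ℕ} (hn : n' ≤ n)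
    {y₀ β C ε h₀ M : ℝ} {N : ℕ} {d : ℕ → ℝ} (hd : ∀ k < N, 1 ≤ d k ∧ d k ≤ M) (hM : 0 ≤ M)
    (hh : 0 < h₀) (hy₀ : 0 ≤ y₀) (hβ : β ≤ y₀) (hC : 0 ≤ C) (hε : ε < 1)
    (hlow : ∀ a : ℕ → E, ∀ y, y₀ ≤ y →
      ‖expSum Λ n' a y‖ ≤ C * expWeightedIntegral β (expSum Λ n' a))
    (hc : ∀ h ∈ Icc h₀ (2 * h₀), ∃ c : ℕ → ℝ, ∑ k ∈ Finset.range N, |c k| ≤ ε ∧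
      ∀ j, n' ≤ j → j < n → ∑ k ∈ Finset.range N, c k * Real.exp (Λ j * (d k * h)) = 1)
    (a : ℕ → E) (y : ℝ) (hy : y₀ ≤ y) :
    ‖expSum Λ n a y‖ ≤ (C * (1 + ε) + ε * N * Real.exp (y₀ + 2 * M * h₀) / h₀) / (1 - ε) *
      expWeightedIntegral (β - 2 * M * h₀) (expSum Λ n a) := by
  set I := expWeightedIntegral (β - 2 * M * h₀) (expSum Λ n a) with hI
  have hI0 : 0 ≤ I := expWeightedIntegral_nonneg _ _
  have hMh : 0 ≤ M * h₀ := by positivity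
  have hε0 : 0 ≤ ε := by
    obtain ⟨c, hc, -⟩ := hc h₀ ⟨le_rfl, by linarith⟩
    exact (Finset.sum_nonneg fun _ _ => abs_nonneg _).trans hc
  have hint : ∀ δ : ℝ,
      IntegrableOn (fun s => Real.exp (-s) * ‖expSum Λ n a (s - δ)‖) (Ioi β) := fun δ => by
    simp_rw [expSum_sub]
    exact integrableOn_expSum hΛ n _ β
  have main : ∀ h ∈ Icc h₀ (2 * h₀), ∃ c : ℕ → ℝ, ∑ k ∈ Finset.range N, |c k| ≤ ε ∧
      ∀ z, y₀ ≤ z → ‖expSum Λ n a z‖ ≤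
        C * (1 + ε) * I + ∑ k ∈ Finset.range N, |c k| * ‖expSum Λ n a (z - d k * h)‖ := by
    intro h hh'
    have hh0 : 0 ≤ h := hh.le.trans hh'.1
    obtain ⟨c, hcs, hce⟩ := hc h hh'
    refine ⟨c, hcs, fun z hz => ?_⟩
    set b : ℕ → E :=
      fun j => (1 - ∑ k ∈ Finset.range N, c k * Real.exp (Λ j * (d k * h))) • a j with hb
    have hT : ∀ s, expSum Λ n' b s =
        expSum Λ n a s - ∑ k ∈ Finset.range N, c k • expSum Λ n a (s - d k * h) := by
      intro s
      have h1 : expSum Λ n' b s = expSum Λ n b s := by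
        refine Finset.sum_subset (Finset.range_mono hn) fun j hj hj' => ?_
        simp only [Finset.mem_range, not_lt] at hj hj'
        simp [hb, hce j hj' hj]
      rw [h1]
      simp_rw [expSum_sub]
      simp only [expSum, hb, sub_smul, one_smul, smul_sub, Finset.sum_sub_distrib, Finset.smul_sum,
        Finset.sum_smul]
      congr 1
      rw [Finset.sum_comm]
      refine Finset.sum_congr rfl fun k _ => Finset.sum_congr rfl fun j _ => ?_
      simp only [smul_smul]
      congr 1
      ring
    have hTI : expWeightedIntegral β (expSum Λ n' b) ≤ (1 + ε) * I := by
      calc expWeightedIntegral β (expSum Λ n' b)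
          ≤ ∫ s in Ioi β, (Real.exp (-s) * ‖expSum Λ n a s‖ + ∑ k ∈ Finset.range N,
              |c k| * (Real.exp (-s) * ‖expSum Λ n a (s - d k * h)‖)) := by
            refine setIntegral_mono_on (integrableOn_expSum hΛ n' b β)
              ((integrableOn_expSum hΛ n a β).add
                (integrable_finsetSum _ fun k _ => (hint _).const_mul _))
              measurableSet_Ioi fun s _ => ?_
            rw [hT]
            calc _ ≤ Real.exp (-s) * (‖expSum Λ n a s‖ + ∑ k ∈ Finset.range N,
                  |c k| * ‖expSum Λ n a (s - d k * h)‖) := by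
                  gcongr
                  refine (norm_sub_le _ _).trans ?_
                  gcongr
                  refine (norm_sum_le _ _).trans (le_of_eq ?_)
                  exact Finset.sum_congr rfl fun k _ => by rw [norm_smul, Real.norm_eq_abs]
              _ = _ := by
                  rw [mul_add, Finset.mul_sum]
                  congr 1
                  exact Finset.sum_congr rfl fun k _ => by ring
        _ = expWeightedIntegral β (expSum Λ n a) + ∑ k ∈ Finset.range N,
              |c k| * expWeightedIntegral β (fun s => expSum Λ n a (s - d k * h)) := by
            rw [integral_add (integrableOn_expSum hΛ n a β)
              (integrable_finsetSum _ fun k _ => (hint _).const_mul _),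
              integral_finsetSum _ fun k _ => (hint _).const_mul _]
            simp only [integral_const_mul]
            rfl
        _ ≤ I + ∑ k ∈ Finset.range N, |c k| * I := by
            gcongr with k hk
            · exact expWeightedIntegral_anti hΛ n a (by linarith)
            · obtain ⟨hd1, hd2⟩ := hd k (Finset.mem_range.1 hk)
              refine expWeightedIntegral_shift_le hΛ n a (by positivity) ?_
              have : d k * h ≤ M * (2 * h₀) := mul_le_mul hd2 hh'.2 hh0 hM
              linarith
        _ ≤ (1 + ε) * I := by
            rw [← Finset.sum_mul]
            nlinarith
    have e := hT z
    have hz' : expSum Λ n a z =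
        expSum Λ n' b z + ∑ k ∈ Finset.range N, c k • expSum Λ n a (z - d k * h) := by
      rw [e]; abel
    rw [hz']
    refine (norm_add_le _ _).trans (add_le_add ?_ ?_)
    · refine (hlow b z hz).trans ?_
      rw [mul_assoc]
      gcongr
    · refine (norm_sum_le _ _).trans (le_of_eq ?_)
      exact Finset.sum_congr rfl fun k _ => by rw [norm_smul, Real.norm_eq_abs]
  set A := C * (1 + ε) * I + ε * N * Real.exp (y₀ + 2 * M * h₀) / h₀ * I with hA
  -- The coefficients depend on h with no measurability known, so each |c_k| is replaced by ε before
  -- integrating over h.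
  have near : ∀ z, y₀ ≤ z → z ≤ y₀ + 2 * M * h₀ → ‖expSum Λ n a z‖ ≤ A := by
    intro z hz hz'
    have hcont := continuous_expSum Λ n a
    have hle : ∀ h ∈ Icc h₀ (2 * h₀), ‖expSum Λ n a z‖ ≤
        C * (1 + ε) * I + ∑ k ∈ Finset.range N, ε * ‖expSum Λ n a (z - d k * h)‖ := by
      intro h hh'
      obtain ⟨c, hcs, hc'⟩ := main h hh'
      refine (hc' z hz).trans ?_
      gcongr with k hk
      exact (Finset.single_le_sum (f := fun k => |c k|) (fun _ _ => abs_nonneg _) hk).trans hcs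
    have hint2 : ∀ k, IntervalIntegrable (fun h => ε * ‖expSum Λ n a (z - d k * h)‖)
        volume h₀ (2 * h₀) := fun k => Continuous.intervalIntegrable (by fun_prop) _ _
    have := intervalIntegral.integral_mono_on (μ := volume) (by linarith : h₀ ≤ 2 * h₀)
      (intervalIntegrable_const) (Continuous.intervalIntegrable (by fun_prop) _ _) hle
    rw [intervalIntegral.integral_const, intervalIntegral.integral_add intervalIntegrable_const
      (Continuous.intervalIntegrable (by fun_prop) _ _), intervalIntegral.integral_const,
      intervalIntegral.integral_finsetSum fun k _ => hint2 k] at this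
    have h2 : ∑ k ∈ Finset.range N, ∫ h in h₀..2 * h₀, ε * ‖expSum Λ n a (z - d k * h)‖ ≤
        ∑ k ∈ Finset.range N, ε * (Real.exp (y₀ + 2 * M * h₀) * I) := by
      refine Finset.sum_le_sum fun k hk => ?_
      rw [intervalIntegral.integral_const_mul]
      obtain ⟨hd1, hd2⟩ := hd k (Finset.mem_range.1 hk)
      gcongr
      refine (integral_norm_expSum_shift_le hΛ n a (γ := β - 2 * M * h₀) hd1 hh ?_).trans ?_
      · have := mul_le_mul_of_nonneg_right hd2 hh.le
        linarith
      · gcongr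
    simp only [Finset.sum_const, Finset.card_range, nsmul_eq_mul, smul_eq_mul] at h2 this
    have h3 : h₀ * ‖expSum Λ n a z‖ ≤ h₀ * A := by
      have : h₀ * A = h₀ * (C * (1 + ε) * I) + N * (ε * (Real.exp (y₀ + 2 * M * h₀) * I)) := by
        rw [hA]; field_simp
      linarith
    exact le_of_mul_le_mul_left h3 hh
  have improve : ∀ S, (∀ z, y₀ ≤ z → ‖expSum Λ n a z‖ ≤ S) →
      ∀ z, y₀ ≤ z → ‖expSum Λ n a z‖ ≤ A + ε * S := by
    intro S hS z hz
    have hS0 : 0 ≤ S := (norm_nonneg _).trans (hS z hz)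
    rcases le_total z (y₀ + 2 * M * h₀) with h | h
    · exact (near z hz h).trans (le_add_of_nonneg_right (by positivity))
    · obtain ⟨c, hcs, hc'⟩ := main h₀ ⟨le_rfl, by linarith⟩
      refine (hc' z hz).trans (add_le_add (le_add_of_nonneg_right (by positivity)) ?_)
      calc ∑ k ∈ Finset.range N, |c k| * ‖expSum Λ n a (z - d k * h₀)‖
          ≤ ∑ k ∈ Finset.range N, |c k| * S := by
            gcongr with k hk
            refine hS _ ?_
            have := mul_le_mul_of_nonneg_right (hd k (Finset.mem_range.1 hk)).2 hh.le
            linarith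
        _ ≤ ε * S := by
            rw [← Finset.sum_mul]
            gcongr
  -- Finiteness of the supremum is what allows S ≤ A + ε S to be solved for S.
  have hbdd : BddAbove ((fun z => ‖expSum Λ n a z‖) '' Ici y₀) := by
    refine ⟨∑ k ∈ Finset.range n, ‖a k‖, ?_⟩
    rintro _ ⟨z, hz, rfl⟩
    exact norm_expSum_le hΛ n a (hy₀.trans hz)
  set S := sSup ((fun z => ‖expSum Λ n a z‖) '' Ici y₀) with hSdef
  have hS : ∀ z, y₀ ≤ z → ‖expSum Λ n a z‖ ≤ S := fun z hz => le_csSup hbdd ⟨z, hz, rfl⟩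
  have hS2 : S ≤ A + ε * S := by
    refine csSup_le ⟨_, y, hy, rfl⟩ ?_
    rintro _ ⟨z, hz, rfl⟩
    exact improve S hS z hz
  have h1ε : 0 < 1 - ε := by linarith
  have : S ≤ A / (1 - ε) := by
    rw [le_div_iff₀ h1ε]
    linarith
  refine (hS y hy).trans (this.trans (le_of_eq ?_))
  rw [hA]
  ring

end ExpSum

/-! ### Uniform point evaluation by dyadic blocks -/

/-- With w = e^{-Λ_j h} ≤ e^{-1} < 1/2, the required identity is ∑ c_k w^k = w^m divided by w^m,
which `exists_pow_reduction` solves. -/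
theorem exists_block_annihilator {Λ : ℕ → ℝ} {n N m : ℕ} {U h : ℝ}
    (hU : ∀ j, n ≤ j → U ≤ Λ j) (hh : 0 < h) (hUh : 1 ≤ U * h) :
    ∃ c : ℕ → ℝ, ∑ k ∈ Finset.range N, |c k| ≤ 7 ^ N * (3 / 4) ^ m ∧
      ∀ j, n ≤ j → j < n + N →
        ∑ k ∈ Finset.range N, c k * Real.exp (Λ j * (((m : ℝ) - k) * h)) = 1 := by
  obtain ⟨c, -, hce, hcn⟩ := exists_pow_reduction (fun i => Real.exp (-(Λ (n + i) * h))) N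
    (fun i _ => ⟨(Real.exp_pos _).le, by
      have h1 : 1 ≤ Λ (n + i) * h := hUh.trans (by gcongr; exact hU _ (by omega))
      calc Real.exp (-(Λ (n + i) * h)) ≤ Real.exp (-1) := by gcongr
        _ ≤ 1 / 2 := by
          have := Real.exp_neg_one_lt_half
          linarith⟩) m
  refine ⟨c, hcn, fun j hj hj' => ?_⟩
  obtain ⟨i, rfl⟩ := Nat.exists_eq_add_of_le hj
  have := hce i (by omega)
  have h1 : ∀ k : ℕ, c k * Real.exp (Λ (n + i) * (((m : ℝ) - k) * h)) =
      Real.exp (Λ (n + i) * (m * h)) * (c k * Real.exp (-(Λ (n + i) * h)) ^ k) := by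
    intro k
    rw [← Real.exp_nat_mul, mul_left_comm (Real.exp _), ← Real.exp_add]
    congr 2
    ring
  simp_rw [h1]
  rw [← Finset.mul_sum, this, ← Real.exp_nat_mul, ← Real.exp_add, Real.exp_eq_one_iff]
  ring

section ExpSum

variable {E : Type*} [NormedAddCommGroup E] [NormedSpace ℝ E]

/-- Exponents are removed one at a time by a single shift with coefficient e^{-Λ_n h}. The constant
depends on n; this only starts the dyadic induction. -/
theorem exists_norm_expSum_le_finite {Λ : ℕ → ℝ} (hΛ : ∀ k, 0 < Λ k) {y₀ : ℝ} (hy₀ : 0 ≤ y₀)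
    (n : ℕ) : ∀ η : ℝ, 0 < η → ∃ C : ℝ, 0 < C ∧ ∀ a : ℕ → E, ∀ y, y₀ ≤ y →
      ‖expSum Λ n a y‖ ≤ C * expWeightedIntegral (y₀ - η) (expSum Λ n a) := by
  induction n with
  | zero => exact fun η _ => ⟨1, one_pos, fun a y _ => by simp [expSum, expWeightedIntegral]⟩
  | succ n ih =>
    intro η hη
    obtain ⟨C, hC, hlow⟩ := ih (η / 2) (by positivity)
    have hε : Real.exp (-(Λ n * (η / 4))) < 1 := by
      rw [Real.exp_lt_one_iff]
      have := mul_pos (hΛ n) (show 0 < η / 4 by positivity)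
      linarith
    have := norm_expSum_le_of_annihilator hΛ (Nat.le_succ n) (d := fun _ => 1) (N := 1) (M := 1)
      (fun _ _ => ⟨le_rfl, le_rfl⟩) zero_le_one (show 0 < η / 4 by positivity) hy₀
      (by linarith) hC.le hε hlow (fun h hh => ⟨fun _ => Real.exp (-(Λ n * h)), by
        have := hΛ n
        have := hh.1
        simp only [Finset.range_one, Finset.sum_singleton, Real.abs_exp]
        gcongr, fun j hj hj' => by
        obtain rfl : j = n := by omega
        simp [← Real.exp_add]⟩)
    have h1ε : 0 < 1 - Real.exp (-(Λ n * (η / 4))) := by linarith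
    refine ⟨(C * (1 + Real.exp (-(Λ n * (η / 4)))) + Real.exp (-(Λ n * (η / 4))) * (1 : ℕ) *
      Real.exp (y₀ + 2 * 1 * (η / 4)) / (η / 4)) / (1 - Real.exp (-(Λ n * (η / 4)))),
      by positivity, fun a y hy => (this a y hy).trans_eq ?_⟩
    have : y₀ - η / 2 - 2 * 1 * (η / 4) = y₀ - η := by ring
    rw [this]

theorem exists_sum_Ico_le {b : ℕ → ℝ} (hb : Summable b) (hb0 : ∀ j, 0 ≤ b j) {η : ℝ} (hη : 0 < η) :
    ∃ J, ∀ j, ∑ i ∈ Finset.Ico J j, b i ≤ η := by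
  obtain ⟨J, hJ⟩ := ((tendsto_sum_nat_add b).eventually_lt_const hη).exists
  refine ⟨J, fun j => ?_⟩
  rw [Finset.sum_Ico_eq_sum_range]
  simp_rw [add_comm J]
  exact (((summable_nat_add_iff J).2 hb).sum_le_tsum _ fun i _ => hb0 _).trans hJ.le

/-- Point evaluations of exponential sums are bounded uniformly on `[y₀, ∞)`. -/
theorem exists_norm_expSum_le {Λ : ℕ → ℝ} (hmono : StrictMono Λ) (hΛ : ∀ k, 0 < Λ k)
    (hsum : Summable fun n => 1 / Λ n) {y₀ : ℝ} (hy₀ : 0 < y₀) :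
    ∃ C : ℝ, 0 < C ∧ ∀ (n : ℕ) (a : ℕ → E) (y : ℝ), y₀ ≤ y →
      ‖expSum Λ n a y‖ ≤ C * expWeightedIntegral 0 (expSum Λ n a) := by
  -- The step size is h₀ = 1/U j. The bound by Λ(2^j) makes the nodes small; the cap 4^j keeps the
  -- factor 1/h₀ from averaging under control when Λ grows fast.
  set U : ℕ → ℝ := fun j => min (Λ (2 ^ j)) (4 ^ j) with hU
  have hU0 : ∀ j, 0 < U j := fun j => lt_min (hΛ _) (by positivity)
  -- The margin 2 M h₀ lost at block j, with M = 20 · 2^j.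
  set b : ℕ → ℝ := fun j => 2 * (20 * 2 ^ j) * (1 / U j) with hb
  have hb0 : ∀ j, 0 ≤ b j := fun j => by have := hU0 j; positivity
  have hbs : Summable b := by
    have h1 : Summable fun j : ℕ => (2 : ℝ) ^ j * (1 / Λ (2 ^ j)) :=
      (summable_condensed_iff_of_nonneg (fun n => by have := hΛ n; positivity)
        fun m n _ hmn => one_div_le_one_div_of_le (hΛ m) (hmono.monotone hmn)).2 hsum
    refine Summable.of_nonneg_of_le hb0 (fun j => ?_)
      ((h1.add (summable_geometric_two)).mul_left 40)
    have h2 : 1 / U j ≤ 1 / Λ (2 ^ j) + 1 / 4 ^ j := by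
      have := hΛ (2 ^ j)
      rcases min_choice (Λ (2 ^ j)) (4 ^ j) with h | h <;> simp only [hU, h]
      · exact le_add_of_nonneg_right (by positivity)
      · exact le_add_of_nonneg_left (by positivity)
    have h3 : (2 : ℝ) ^ j * (1 / 4 ^ j) = (1 / 2) ^ j := by
      rw [← one_div_pow, ← mul_pow]
      norm_num
    calc b j = 40 * (2 ^ j * (1 / U j)) := by simp only [hb]; ring
      _ ≤ 40 * (2 ^ j * (1 / Λ (2 ^ j) + 1 / 4 ^ j)) := by gcongr
      _ = _ := by rw [mul_add, h3]
  obtain ⟨J, hJ⟩ := exists_sum_Ico_le hbs hb0 (half_pos hy₀)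
  obtain ⟨C₀, hC₀, hC₁, hbase⟩ : ∃ C₀ : ℝ, 0 < C₀ ∧ 1 ≤ C₀ ∧ ∀ (a : ℕ → E) (y : ℝ), y₀ ≤ y →
      ‖expSum Λ (2 ^ J) a y‖ ≤ C₀ * expWeightedIntegral (y₀ - y₀ / 2) (expSum Λ (2 ^ J) a) := by
    obtain ⟨C, hC, h⟩ := exists_norm_expSum_le_finite (E := E) hΛ hy₀.le (2 ^ J) (y₀ / 2)
      (half_pos hy₀)
    refine ⟨C + 1, by positivity, by linarith, fun a y hy => (h a y hy).trans ?_⟩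
    exact mul_le_mul_of_nonneg_right (by linarith) (expWeightedIntegral_nonneg _ _)
  -- Block j multiplies the constant by at most e^{K 2^{-j}}, so the total growth stays below
  -- e^{2K}.
  set K : ℝ := 1 + Real.exp (y₀ + y₀ / 2) with hK
  have hK0 : 0 < K := by positivity
  have ind : ∀ j, J ≤ j → ∀ (a : ℕ → E) (y : ℝ), y₀ ≤ y → ‖expSum Λ (2 ^ j) a y‖ ≤
      C₀ * Real.exp (2 * K * (1 - (1 / 2) ^ j)) *
        expWeightedIntegral (y₀ - y₀ / 2 - ∑ i ∈ Finset.Ico J j, b i) (expSum Λ (2 ^ j) a) := by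
    intro j hj
    induction j, hj using Nat.le_induction with
    | base =>
      intro a y hy
      rw [Finset.Ico_self, Finset.sum_empty, sub_zero]
      refine (hbase a y hy).trans (mul_le_mul_of_nonneg_right ?_ (expWeightedIntegral_nonneg _ _))
      refine le_mul_of_one_le_right hC₀.le (Real.one_le_exp ?_)
      have : (1 / 2 : ℝ) ^ J ≤ 1 := pow_le_one₀ (by norm_num) (by norm_num)
      exact mul_nonneg (by positivity) (by linarith)
    | succ j hj ih =>
      intro a y hy
      set ε : ℝ := (1 / 16) ^ (j + 1) with hε
      have hε0 : 0 < ε := by positivity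
      have hε1 : ε ≤ 1 / 16 := by
        rw [hε, pow_succ]
        exact mul_le_of_le_one_left (by norm_num) (pow_le_one₀ (by norm_num) (by norm_num))
      have hstep := norm_expSum_le_of_annihilator hΛ (n := 2 ^ (j + 1))
        (Nat.pow_le_pow_right two_pos (Nat.le_succ j))
        (N := 2 ^ j) (d := fun k => ((20 * 2 ^ j : ℕ) : ℝ) - k) (M := 20 * 2 ^ j) (ε := ε)
        (fun k hk => by
          have h1 : ((k + 1 : ℕ) : ℝ) ≤ ((20 * 2 ^ j : ℕ) : ℝ) := Nat.cast_le.2 (by omega)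
          push_cast at h1 ⊢
          exact ⟨by linarith, by linarith [k.cast_nonneg (α := ℝ)]⟩) (by positivity)
        (one_div_pos.2 (hU0 j)) hy₀.le
        (by linarith [Finset.sum_nonneg fun i (_ : i ∈ Finset.Ico J j) => hb0 i])
        (by positivity) (by linarith) ih
        (fun h hh => by
          obtain ⟨c, hc1, hc2⟩ := exists_block_annihilator (Λ := Λ) (n := 2 ^ j) (N := 2 ^ j)
            (m := 20 * 2 ^ j) (U := U j) (h := h)
            (fun i hi => (min_le_left _ _).trans (hmono.monotone hi))
            ((one_div_pos.2 (hU0 j)).trans_le hh.1) (by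
              have := mul_le_mul_of_nonneg_left hh.1 (hU0 j).le
              rwa [mul_one_div_cancel (hU0 j).ne'] at this)
          refine ⟨c, hc1.trans ?_, fun i hi hi' => hc2 i hi (by rw [pow_succ] at hi'; omega)⟩
          -- The choice m = 20N gives 7^N (3/4)^m = (7 (3/4)^20)^N ≤ 16^{-N}.
          rw [pow_mul, ← mul_pow]
          calc (7 * (3 / 4 : ℝ) ^ 20) ^ 2 ^ j ≤ (1 / 16) ^ 2 ^ j := by
                gcongr
                norm_num
            _ ≤ ε := pow_le_pow_of_le_one (by norm_num) (by norm_num) Nat.lt_two_pow_self) a y hy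
      have hbj : 2 * (20 * 2 ^ j) * (1 / U j) = b j := rfl
      have hbj' : b j ≤ y₀ / 2 := by
        refine le_trans ?_ (hJ (j + 1))
        exact Finset.single_le_sum (f := b) (fun i _ => hb0 i) (Finset.mem_Ico.2 ⟨hj, by omega⟩)
      rw [hbj] at hstep
      rw [Finset.sum_Ico_succ_top hj, ← sub_sub]
      refine hstep.trans (mul_le_mul_of_nonneg_right ?_ (expWeightedIntegral_nonneg _ _))
      set X := Real.exp (2 * K * (1 - (1 / 2) ^ j)) with hX
      set t : ℝ := (1 / 2) ^ j with ht
      have ht0 : 0 < t := by positivity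
      have ht1 : t ≤ 1 := pow_le_one₀ (by norm_num) (by norm_num)
      have hεt : ε ≤ t / 16 := by
        rw [hε, pow_succ, ← div_eq_mul_one_div]
        gcongr
        exact pow_le_pow_left₀ (by norm_num) (by norm_num) j
      have hD : ε * ((2 ^ j : ℕ) : ℝ) * Real.exp (y₀ + b j) / (1 / U j) ≤ (K - 1) * t / 16 := by
        have h1 : Real.exp (y₀ + b j) ≤ K - 1 := by
          rw [hK, add_sub_cancel_left]
          gcongr
        have h2 : U j ≤ 4 ^ j := min_le_right _ _
        have h3 : ε * 2 ^ j * 4 ^ j = t / 16 := by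
          have : (1 / 16 : ℝ) ^ j * 2 ^ j * 4 ^ j = (1 / 2) ^ j := by
            rw [← mul_pow, ← mul_pow]
            norm_num
          rw [hε, pow_succ, ht, ← this]
          ring
        have h4 := hU0 j
        have h5 : 0 ≤ K - 1 := (Real.exp_pos _).le.trans h1
        rw [div_div_eq_mul_div, div_one, Nat.cast_pow, Nat.cast_ofNat]
        calc ε * 2 ^ j * Real.exp (y₀ + b j) * U j ≤ ε * 2 ^ j * (K - 1) * 4 ^ j := by gcongr
          _ = (K - 1) * (ε * 2 ^ j * 4 ^ j) := by ring
          _ = _ := by rw [h3]; ring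
      have hX1 : 1 ≤ C₀ * X := one_le_mul_of_one_le_of_one_le hC₁
        (Real.one_le_exp (mul_nonneg (by positivity) (by linarith)))
      have hXe : Real.exp (2 * K * (1 - (1 / 2) ^ (j + 1))) = X * Real.exp (K * t) := by
        rw [hX, ← Real.exp_add, pow_succ, ← ht]
        congr 1
        ring
      have hK1 : 1 ≤ K := by
        rw [hK]
        exact le_add_of_nonneg_right (Real.exp_pos _).le
      rw [div_le_iff₀ (by linarith), hXe, ← mul_assoc]
      have hexp : 1 + K * t ≤ Real.exp (K * t) := by linarith [Real.add_one_le_exp (K * t)]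
      have hKt : t ≤ K * t := le_mul_of_one_le_left ht0.le hK1
      calc C₀ * X * (1 + ε) + ε * ((2 ^ j : ℕ) : ℝ) * Real.exp (y₀ + b j) / (1 / U j)
          ≤ C₀ * X * (1 + t / 16) + C₀ * X * ((K - 1) * t / 16) := by
            refine add_le_add (by gcongr) (hD.trans (le_mul_of_one_le_left ?_ hX1))
            have := sub_nonneg.2 hK1
            positivity
        _ = C₀ * X * (1 + K * t / 16) := by ring
        _ ≤ C₀ * X * ((1 + K * t) * (1 - t / 16)) := by
            gcongr
            nlinarith
        _ ≤ C₀ * X * (Real.exp (K * t) * (1 - ε)) := by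
            gcongr
            linarith
        _ = _ := by ring
  refine ⟨C₀ * Real.exp (2 * K), by positivity, fun n a y hy => ?_⟩
  set j := max J n with hj
  have hnj : n ≤ 2 ^ j := (le_max_right J n).trans Nat.lt_two_pow_self.le
  have he : expSum Λ (2 ^ j) (fun k => if k < n then a k else 0) = expSum Λ n a := by
    funext s
    simp only [expSum]
    rw [← Finset.sum_subset (Finset.range_mono hnj)]
    · exact Finset.sum_congr rfl fun k hk => by rw [if_pos (Finset.mem_range.1 hk)]
    · intro k _ hk
      rw [if_neg (by simpa using hk), smul_zero]
  have := ind j (le_max_left J n) (fun k => if k < n then a k else 0) y hy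
  rw [he] at this
  refine this.trans (mul_le_mul ?_ (expWeightedIntegral_anti hΛ n a ?_)
    (expWeightedIntegral_nonneg _ _) (by positivity))
  · refine mul_le_mul_of_nonneg_left (Real.exp_le_exp.2 ?_) hC₀.le
    refine mul_le_of_le_one_right (by positivity) (sub_le_self _ (by positivity))
  · linarith [hJ j]

end ExpSum

/-! ### Müntz polynomials and continuous representatives -/

section Muntz

variable {𝕜 : Type*} [RCLike 𝕜] {Λ : ℕ → ℝ}

/-- The Müntz polynomials with exponents `Λ`, as functions on `ℝ`. -/
noncomputable def muntzPolynomials (𝕜 : Type*) [RCLike 𝕜] (Λ : ℕ → ℝ) : Submodule 𝕜 (ℝ → 𝕜) :=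
  Submodule.span 𝕜 (range fun (n : ℕ) (x : ℝ) => ((x ^ Λ n : ℝ) : 𝕜))

theorem continuous_of_mem_muntzPolynomials (hpos : ∀ n, 0 < Λ n) {P : ℝ → 𝕜}
    (hP : P ∈ muntzPolynomials 𝕜 Λ) : Continuous P := by
  induction hP using Submodule.span_induction with
  | mem P h =>
    obtain ⟨n, rfl⟩ := h
    exact RCLike.continuous_ofReal.comp (Real.continuous_rpow_const (hpos n).le)
  | zero => exact continuous_zero
  | add P Q _ _ hP hQ => exact hP.add hQ
  | smul c P _ hP => exact hP.const_smul c

theorem apply_zero_of_mem_muntzPolynomials (hpos : ∀ n, 0 < Λ n) {P : ℝ → 𝕜}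
    (hP : P ∈ muntzPolynomials 𝕜 Λ) : P 0 = 0 := by
  induction hP using Submodule.span_induction with
  | mem P h =>
    obtain ⟨n, rfl⟩ := h
    simp [Real.zero_rpow (hpos n).ne']
  | zero => rfl
  | add P Q _ _ hP hQ => simp [hP, hQ]
  | smul c P _ hP => simp [hP]

theorem exists_expSum_of_mem_muntzPolynomials {P : ℝ → 𝕜} (hP : P ∈ muntzPolynomials 𝕜 Λ) :
    ∃ (n : ℕ) (a : ℕ → 𝕜), ∀ s, P (Real.exp (-s)) = expSum Λ n a s := by
  obtain ⟨c, rfl⟩ := Finsupp.mem_span_range_iff_exists_finsupp.1 hP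
  refine ⟨c.support.sup id + 1, c, fun s => ?_⟩
  rw [Finsupp.sum, Finset.sum_apply, expSum]
  rw [Finset.sum_subset (s₂ := Finset.range (c.support.sup id + 1))]
  · refine Finset.sum_congr rfl fun k _ => ?_
    rw [RCLike.real_smul_eq_coe_mul, Pi.smul_apply, smul_eq_mul, mul_comm, ← Real.exp_mul]
    congr 3
    ring
  · intro k hk
    exact Finset.mem_range.2 (Nat.lt_succ_of_le (Finset.le_sup (f := id) hk))
  · intro k _ hk
    simp [Finsupp.notMem_support_iff.1 hk]

theorem integral_unitMeasure_eq (u : ℝ → ℝ) :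
    ∫ x, u x ∂unitMeasure = ∫ s in Ioi (0 : ℝ), Real.exp (-s) * u (Real.exp (-s)) := by
  have himg : (fun s => Real.exp (-s)) '' Ioi 0 = Ioo 0 1 := by
    ext x
    constructor
    · rintro ⟨s, hs, rfl⟩
      exact ⟨Real.exp_pos _, Real.exp_lt_one_iff.2 (neg_lt_zero.2 hs)⟩
    · rintro ⟨h0, h1⟩
      exact ⟨-Real.log x, neg_pos.2 (Real.log_neg h0 h1), by simp [Real.exp_log h0]⟩
  have hinj : InjOn (fun s => Real.exp (-s)) (Ioi 0) := fun s _ t _ h => by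
    simpa using h
  have hder : ∀ s ∈ Ioi (0 : ℝ),
      HasDerivWithinAt (fun s => Real.exp (-s)) (-Real.exp (-s)) (Ioi 0) s := fun s _ => by
    simpa using ((hasDerivAt_neg s).exp).hasDerivWithinAt
  have := integral_image_eq_integral_abs_deriv_smul measurableSet_Ioi hder hinj u
  rw [unitMeasure, integral_Icc_eq_integral_Ioo, ← himg, this]
  simp [abs_neg, Real.abs_exp]

/-- Müntz polynomials are bounded on `[0,r]`, `r < 1`, by their `L¹` norm. -/
theorem exists_norm_le_of_mem_muntzPolynomials (𝕜 : Type*) [RCLike 𝕜] (hmono : StrictMono Λ)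
    (hpos : ∀ n, 0 < Λ n) (hsum : Summable fun n => 1 / Λ n) (r : ℝ) (hr : r < 1) :
    ∃ C : ℝ, 0 ≤ C ∧ ∀ P ∈ muntzPolynomials 𝕜 Λ, ∀ x ∈ Icc 0 r,
      ‖P x‖ ≤ C * ∫ t, ‖P t‖ ∂unitMeasure := by
  obtain hr0 | hr0 := le_or_gt r 0
  · refine ⟨0, le_rfl, fun P hP x hx => ?_⟩
    have : x = 0 := le_antisymm (hx.2.trans hr0) hx.1
    simp [this, apply_zero_of_mem_muntzPolynomials hpos hP]
  obtain ⟨C, hC, h⟩ := exists_norm_expSum_le (E := 𝕜) hmono hpos hsum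
    (neg_pos.2 (Real.log_neg hr0 hr))
  refine ⟨C, hC.le, fun P hP x hx => ?_⟩
  obtain hx0 | hx0 := hx.1.eq_or_lt
  · rw [← hx0, apply_zero_of_mem_muntzPolynomials hpos hP, norm_zero]
    exact mul_nonneg hC.le (integral_nonneg fun _ => norm_nonneg _)
  obtain ⟨n, a, ha⟩ := exists_expSum_of_mem_muntzPolynomials hP
  have := h n a (-Real.log x) (neg_le_neg (Real.log_le_log hx0 hx.2))
  rw [← ha, neg_neg, Real.exp_log hx0] at this
  rw [integral_unitMeasure_eq]
  simpa only [ha, expWeightedIntegral] using this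

theorem exists_muntzPolynomial_ae_eq {p : Lp 𝕜 1 unitMeasure}
    (hp : p ∈ Submodule.span 𝕜 {f : Lp 𝕜 1 unitMeasure |
      ∃ n, ⇑f =ᵐ[unitMeasure] fun x => ((x ^ Λ n : ℝ) : 𝕜)}) :
    ∃ P ∈ muntzPolynomials 𝕜 Λ, ⇑p =ᵐ[unitMeasure] P := by
  induction hp using Submodule.span_induction with
  | mem p h =>
    obtain ⟨n, hn⟩ := h
    exact ⟨_, Submodule.subset_span ⟨n, rfl⟩, hn⟩
  | zero => exact ⟨0, zero_mem _, Lp.coeFn_zero _ _ _⟩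
  | add p q _ _ hp hq =>
    obtain ⟨P, hP, hp⟩ := hp
    obtain ⟨Q, hQ, hq⟩ := hq
    exact ⟨P + Q, add_mem hP hQ, (Lp.coeFn_add p q).trans (hp.add hq)⟩
  | smul c p _ hp =>
    obtain ⟨P, hP, hp⟩ := hp
    exact ⟨c • P, Submodule.smul_mem _ c hP, (Lp.coeFn_smul c p).trans (hp.const_smul c)⟩

theorem ae_unitMeasure_mem_Ico : ∀ᵐ x ∂unitMeasure, x ∈ Ico (0 : ℝ) 1 := by
  rw [unitMeasure, ← restrict_Ico_eq_restrict_Icc]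
  exact ae_restrict_mem measurableSet_Ico

/-- Every element of `M¹_Λ` has a continuous representative, which on `[0,r]` is bounded by the
norm of the class. -/
theorem exists_isContRepr (hpos : ∀ n, 0 < Λ n) {C : ℝ → ℝ}
    (hC : ∀ r < 1, ∀ P ∈ muntzPolynomials 𝕜 Λ, ∀ x ∈ Icc 0 r,
      ‖P x‖ ≤ C r * ∫ t, ‖P t‖ ∂unitMeasure)
    (hC0 : ∀ r < 1, 0 ≤ C r) {f : Lp 𝕜 1 unitMeasure} (hf : f ∈ muntzSpace 𝕜 Λ) :
    ∃ g : ℝ → 𝕜, IsContRepr g f ∧ ∀ r < 1, ∀ x ∈ Icc 0 r, ‖g x‖ ≤ C r * ‖f‖ := by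
  obtain ⟨p, hp, hpf⟩ := mem_closure_iff_seq_limit.1 (show f ∈ closure _ from hf)
  choose P hP hpP using fun k => exists_muntzPolynomial_ae_eq (hp k)
  have hPn : ∀ k, ∫ t, ‖P k t‖ ∂unitMeasure = ‖p k‖ := fun k => by
    rw [L1.norm_eq_integral_norm]
    exact integral_congr_ae ((hpP k).symm.fun_comp norm)
  have hPd : ∀ k l, ∫ t, ‖(P k - P l) t‖ ∂unitMeasure = dist (p k) (p l) := fun k l => by
    rw [dist_eq_norm, L1.norm_eq_integral_norm]
    exact integral_congr_ae (((Lp.coeFn_sub _ _).trans ((hpP k).sub (hpP l))).symm.fun_comp norm)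
  have hcau := hpf.cauchySeq
  have hunif : ∀ r < 1, UniformCauchySeqOn P atTop (Icc 0 r) := by
    intro r hr
    rw [Metric.uniformCauchySeqOn_iff]
    intro ε hε
    have h1 : 0 < C r + 1 := by linarith [hC0 r hr]
    obtain ⟨N, hN⟩ := Metric.cauchySeq_iff.1 hcau (ε / (C r + 1)) (by positivity)
    refine ⟨N, fun k hk l hl x hx => ?_⟩
    have h2 := hC r hr _ (sub_mem (hP k) (hP l)) x hx
    rw [hPd, Pi.sub_apply, ← dist_eq_norm] at h2
    have h3 := hN k hk l hl
    rw [lt_div_iff₀ h1] at h3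
    nlinarith [dist_nonneg (x := p k) (y := p l)]
  have hlim : ∀ x ∈ Ico (0 : ℝ) 1, ∃ l, Tendsto (fun k => P k x) atTop (𝓝 l) := fun x hx =>
    cauchySeq_tendsto_of_complete ((hunif x hx.2).cauchySeq (right_mem_Icc.2 hx.1))
  choose! g₀ hg₀ using hlim
  have hIcc : ∀ {r x : ℝ}, r < 1 → x ∈ Icc 0 r → x ∈ Ico (0 : ℝ) 1 :=
    fun hr hx => ⟨hx.1, hx.2.trans_lt hr⟩
  have hcont : ContinuousOn g₀ (Ico 0 1) := by
    intro x hx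
    obtain ⟨r, hxr, hr⟩ := exists_between hx.2
    have h1 : ContinuousOn g₀ (Icc 0 r) :=
      ((hunif r hr).tendstoUniformlyOn_of_tendsto fun y hy => hg₀ y (hIcc hr hy)).continuousOn
        (Frequently.of_forall fun k => (continuous_of_mem_muntzPolynomials hpos (hP k)).continuousOn)
    refine (h1 x ⟨hx.1, hxr.le⟩).mono_of_mem_nhdsWithin ?_
    filter_upwards [self_mem_nhdsWithin, mem_nhdsWithin_of_mem_nhds (Iio_mem_nhds hxr)]
      with y hy hy'
    exact ⟨hy.1, (mem_Iio.1 hy').le⟩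
  have hae : g₀ =ᵐ[unitMeasure] f := by
    obtain ⟨ns, hns, hns'⟩ := (tendstoInMeasure_of_tendsto_Lp hpf).exists_seq_tendsto_ae
    filter_upwards [hns', ae_all_iff.2 hpP, ae_unitMeasure_mem_Ico] with x h1 h2 h3
    simp only [h2] at h1
    exact tendsto_nhds_unique ((hg₀ x h3).comp hns.tendsto_atTop) h1
  -- The value at 1 is the left limit when it exists and a default otherwise, as `IsContRepr`
  -- requires.
  set g := Function.update g₀ 1 (limUnder (𝓝[<] 1) g₀) with hg
  have hgg : EqOn g g₀ (Iio 1) := fun x hx => Function.update_of_ne (ne_of_lt hx) _ _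
  refine ⟨g, ⟨?_, ?_, ?_⟩, ?_⟩
  · filter_upwards [hae, ae_unitMeasure_mem_Ico] with x h1 h2
    rw [hgg h2.2, h1]
  · exact hcont.congr fun x hx => hgg hx.2
  · intro l hl
    have : Tendsto g₀ (𝓝[<] 1) (𝓝 l) := hl.congr' (eventually_of_mem self_mem_nhdsWithin hgg)
    rw [hg, Function.update_self, this.limUnder_eq]
  · intro r hr x hx
    rw [hgg (hx.2.trans_lt hr)]
    refine le_of_tendsto_of_tendsto' (hg₀ x (hIcc hr hx)).norm (hpf.norm.const_mul (C r))
      fun k => ?_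
    rw [← hPn]
    exact hC r hr _ (hP k) x hx

theorem eqOn_Ico_of_ae_eq_unitMeasure {u v : ℝ → 𝕜} (hu : ContinuousOn u (Ico 0 1))
    (hv : ContinuousOn v (Ico 0 1)) (h : u =ᵐ[unitMeasure] v) : EqOn u v (Ico 0 1) := by
  rw [unitMeasure, ← restrict_Ico_eq_restrict_Icc] at h
  exact Measure.eqOn_Ico_of_ae_eq _ h hu hv

end Muntz

/-! ### Sufficiency -/

section Composition

variable {𝕜 : Type*} [RCLike 𝕜] {Λ : ℕ → ℝ}

theorem lintegral_enorm_eq_of_isContRepr {g : ℝ → 𝕜} {f : Lp 𝕜 1 unitMeasure}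
    (hg : IsContRepr g f) : ∫⁻ x in Icc 0 1, ‖g x‖ₑ = ‖f‖ₑ := by
  rw [Lp.enorm_def, eLpNorm_one_eq_lintegral_enorm]
  exact lintegral_congr_ae (hg.ae_eq.fun_comp enorm)

/-- Change of variables near a point where the derivative does not vanish. -/
theorem exists_nhds_lintegral_comp_le {φ : ℝ → ℝ} (hφ : ContDiffOn ℝ 1 φ (Icc 0 1))
    (hmaps : MapsTo φ (Icc 0 1) (Icc 0 1)) {x₀ : ℝ} (hx₀ : x₀ ∈ Icc (0 : ℝ) 1)
    (hd : derivWithin φ (Icc 0 1) x₀ ≠ 0) :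
    ∃ t ∈ 𝓝[Icc 0 1] x₀, ∃ K : ENNReal, K ≠ ⊤ ∧
      ∀ u : ℝ → ENNReal, ∫⁻ x in t, u (φ x) ≤ K * ∫⁻ x in Icc 0 1, u x := by
  set d := derivWithin φ (Icc 0 1) x₀ with hd'
  have hd0 : 0 < |d| / 2 := by positivity
  have hcont := hφ.continuousOn_derivWithin (uniqueDiffOn_Icc_zero_one) le_rfl
  obtain ⟨δ, hδ, hball⟩ := Metric.mem_nhdsWithin_iff.1
    (hcont x₀ hx₀ (Metric.closedBall_mem_nhds d hd0))
  set t := Metric.ball x₀ δ ∩ Icc 0 1 with ht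
  have htm : MeasurableSet t := Metric.isOpen_ball.measurableSet.inter measurableSet_Icc
  have htc : Convex ℝ t := (convex_ball x₀ δ).inter (convex_Icc 0 1)
  have hclose : ∀ x ∈ t, |derivWithin φ (Icc 0 1) x - d| ≤ |d| / 2 := fun x hx => hball hx
  have hder : ∀ x ∈ t, HasDerivWithinAt φ (derivWithin φ (Icc 0 1) x) t x := fun x hx =>
    ((hφ.differentiableOn one_ne_zero x hx.2).hasDerivWithinAt).mono inter_subset_right
  -- φ - d·x is |d|/2-Lipschitz on the convex set t, so φ cannot take a value twice there.
  have hinj : InjOn φ t := by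
    intro x hx y hy hxy
    have h1 := htc.norm_image_sub_le_of_norm_hasDerivWithin_le (f := fun z => φ z - d * z)
      (f' := fun z => derivWithin φ (Icc 0 1) z - d) (C := |d| / 2)
      (fun z hz => (hder z hz).sub (by simpa using ((hasDerivWithinAt_id z t).const_mul d)))
      hclose hx hy
    simp only [hxy, Real.norm_eq_abs] at h1
    have h2 : φ y - d * y - (φ y - d * x) = -(d * (y - x)) := by ring
    rw [h2, abs_neg, abs_mul] at h1
    have h3 : |y - x| = 0 := by nlinarith [abs_nonneg (y - x)]
    linarith [abs_eq_zero.1 h3]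
  refine ⟨t, inter_mem (mem_nhdsWithin_of_mem_nhds (Metric.ball_mem_nhds _ hδ))
    self_mem_nhdsWithin, (ENNReal.ofReal (|d| / 2))⁻¹, by simpa using hd0, fun u => ?_⟩
  have h1 := lintegral_image_eq_lintegral_abs_deriv_mul htm hder hinj u
  have h2 : ENNReal.ofReal (|d| / 2) * ∫⁻ x in t, u (φ x) ≤ ∫⁻ x in Icc 0 1, u x := by
    rw [← lintegral_const_mul' _ _ ENNReal.ofReal_ne_top]
    refine (setLIntegral_mono' htm fun x hx => ?_).trans (h1.symm.le.trans
      (lintegral_mono_set (hmaps.mono_left inter_subset_right).image_subset))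
    gcongr
    have := abs_sub_abs_le_abs_sub d (derivWithin φ (Icc 0 1) x)
    rw [abs_sub_comm] at this
    linarith [hclose x hx]
  rw [← ENNReal.div_eq_inv_mul, ENNReal.le_div_iff_mul_le (by simp [hd]) (by simp), mul_comm]
  exact h2

/-- The condition that makes `C_φ` locally bounded makes it bounded. -/
theorem compositionBounded_of_forall (hmono : StrictMono Λ) (hpos : ∀ n, 0 < Λ n)
    (hsum : Summable fun n => 1 / Λ n) {φ : ℝ → ℝ} (hφ : ContDiffOn ℝ 1 φ (Icc 0 1))
    (hmaps : MapsTo φ (Icc 0 1) (Icc 0 1)) (hnull : volume (Icc 0 1 ∩ φ ⁻¹' {1}) = 0)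
    (hd : ∀ x₀ ∈ Icc (0 : ℝ) 1, φ x₀ = 1 → derivWithin φ (Icc 0 1) x₀ ≠ 0) :
    CompositionBounded 𝕜 Λ φ := by
  choose! C hC0 hC using exists_norm_le_of_mem_muntzPolynomials 𝕜 hmono hpos hsum
  choose G hG hGb using fun f : muntzSpace 𝕜 Λ => exists_isContRepr hpos hC hC0 f.2
  have hclosed : ∀ s : Set ℝ, IsClosed s → IsClosed (Icc 0 1 ∩ φ ⁻¹' s) := fun s hs =>
    hφ.continuousOn.preimage_isClosed_of_isClosed isClosed_Icc hs
  have hbound : ∃ K : ENNReal, K ≠ ⊤ ∧ ∀ f, ∫⁻ x in Icc 0 1, ‖G f (φ x)‖ₑ ≤ K * ‖f‖ₑ := by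
    refine isCompact_Icc.induction_on
      (p := fun s => ∃ K : ENNReal, K ≠ ⊤ ∧ ∀ f, ∫⁻ x in s, ‖G f (φ x)‖ₑ ≤ K * ‖f‖ₑ)
      ⟨0, by simp⟩ ?_ ?_ ?_
    · rintro s t hst ⟨K, hK, h⟩
      exact ⟨K, hK, fun f => (lintegral_mono_set hst).trans (h f)⟩
    · rintro s t ⟨K, hK, h⟩ ⟨K', hK', h'⟩
      refine ⟨K + K', ENNReal.add_ne_top.2 ⟨hK, hK'⟩, fun f => (lintegral_union_le _ _ _).trans ?_⟩
      rw [add_mul]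
      exact add_le_add (h f) (h' f)
    · intro x₀ hx₀
      obtain h1 | h1 := (hmaps hx₀).2.eq_or_lt
      · obtain ⟨t, ht, K, hK, h⟩ := exists_nhds_lintegral_comp_le hφ hmaps hx₀ (hd x₀ hx₀ h1)
        refine ⟨t, ht, K, hK, fun f => (h fun y => ‖G f y‖ₑ).trans_eq ?_⟩
        rw [lintegral_enorm_eq_of_isContRepr (hG f)]
        rfl
      · obtain ⟨r, hr, hr1⟩ := exists_between h1
        refine ⟨Icc 0 1 ∩ φ ⁻¹' Iic r, inter_mem self_mem_nhdsWithin
          (hφ.continuousOn x₀ hx₀ (Iic_mem_nhds hr)), ENNReal.ofReal (C r),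
          ENNReal.ofReal_ne_top, fun f => ?_⟩
        calc ∫⁻ x in Icc 0 1 ∩ φ ⁻¹' Iic r, ‖G f (φ x)‖ₑ
            ≤ ∫⁻ x in Icc 0 1 ∩ φ ⁻¹' Iic r, ENNReal.ofReal (C r) * ‖f‖ₑ := by
              refine setLIntegral_mono' (hclosed _ isClosed_Iic).measurableSet fun x hx => ?_
              rw [← ofReal_norm, ← ofReal_norm, ← ENNReal.ofReal_mul (hC0 r hr1)]
              exact ENNReal.ofReal_le_ofReal (hGb f r hr1 _ ⟨(hmaps hx.1).1, hx.2⟩)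
          _ ≤ ∫⁻ x in Icc (0 : ℝ) 1, ENNReal.ofReal (C r) * ‖f‖ₑ :=
              lintegral_mono_set inter_subset_left
          _ = ENNReal.ofReal (C r) * ‖f‖ₑ := by simp
  obtain ⟨K, hK, hKb⟩ := hbound
  -- Values of representatives at 1 are thus irrelevant almost everywhere, which makes f ↦ `G f ∘ φ`
  -- linear although G is only a choice.
  have hφ1 : ∀ᵐ x ∂unitMeasure, φ x ∈ Ico (0 : ℝ) 1 := by
    rw [unitMeasure, ae_restrict_iff' measurableSet_Icc]
    filter_upwards [measure_eq_zero_iff_ae_notMem.1 hnull] with x hx hx'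
    exact ⟨(hmaps hx').1, lt_of_le_of_ne (hmaps hx').2 fun h => hx ⟨hx', h⟩⟩
  have hmeas : ∀ f, AEStronglyMeasurable (G f ∘ φ) unitMeasure := by
    intro f
    set s := Icc (0 : ℝ) 1 \ (Icc 0 1 ∩ φ ⁻¹' {1}) with hs
    have hsm : MeasurableSet s :=
      measurableSet_Icc.diff (hclosed _ isClosed_singleton).measurableSet
    have hcont : ContinuousOn (G f ∘ φ) s :=
      (hG f).continuousOn.comp (hφ.continuousOn.mono sdiff_subset) fun x hx =>
        ⟨(hmaps hx.1).1, lt_of_le_of_ne (hmaps hx.1).2 fun h => hx.2 ⟨hx.1, h⟩⟩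
    have := hcont.aestronglyMeasurable (μ := volume) hsm
    rwa [hs, Measure.restrict_congr_set (sdiff_null_ae_eq_self hnull)] at this
  have hnorm : ∀ f, eLpNorm (G f ∘ φ) 1 unitMeasure ≤ K * ‖f‖ₑ := fun f => by
    rw [eLpNorm_one_eq_lintegral_enorm]
    exact hKb f
  have hmem : ∀ f, MemLp (G f ∘ φ) 1 unitMeasure := fun f =>
    ⟨hmeas f, (hnorm f).trans_lt (ENNReal.mul_lt_top hK.lt_top enorm_lt_top)⟩
  have hadd : ∀ f g, (G (f + g) ∘ φ) =ᵐ[unitMeasure] G f ∘ φ + G g ∘ φ := by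
    intro f g
    have h := eqOn_Ico_of_ae_eq_unitMeasure (hG (f + g)).continuousOn
      ((hG f).continuousOn.add (hG g).continuousOn) ((hG (f + g)).ae_eq.trans
        ((Lp.coeFn_add (f : Lp 𝕜 1 unitMeasure) g).trans
          ((hG f).ae_eq.add (hG g).ae_eq).symm))
    filter_upwards [hφ1] with x hx using h hx
  have hsmul : ∀ (c : 𝕜) f, (G (c • f) ∘ φ) =ᵐ[unitMeasure] c • (G f ∘ φ) := by
    intro c f
    have h := eqOn_Ico_of_ae_eq_unitMeasure (hG (c • f)).continuousOn
      ((hG f).continuousOn.const_smul c) ((hG (c • f)).ae_eq.trans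
        ((Lp.coeFn_smul c (f : Lp 𝕜 1 unitMeasure)).trans ((hG f).ae_eq.const_smul c).symm))
    filter_upwards [hφ1] with x hx using h hx
  let T : muntzSpace 𝕜 Λ →ₗ[𝕜] Lp 𝕜 1 unitMeasure :=
    { toFun := fun f => (hmem f).toLp
      map_add' := fun f g => by
        rw [← MemLp.toLp_add]
        exact MemLp.toLp_congr _ _ (hadd f g)
      map_smul' := fun c f => by
        rw [RingHom.id_apply, ← MemLp.toLp_const_smul]
        exact MemLp.toLp_congr _ _ (hsmul c f) }
  refine ⟨T.mkContinuous K.toReal fun f => ?_, fun f => ⟨G f, hG f, (hmem f).coeFn_toLp⟩⟩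
  have h : ‖T f‖ₑ ≤ K * ‖f‖ₑ := (Lp.enorm_toLp (hf := hmem f)).trans_le (hnorm f)
  have := ENNReal.toReal_mono (ENNReal.mul_ne_top hK enorm_ne_top) h
  rwa [ENNReal.toReal_mul, toReal_enorm, toReal_enorm] at this

end Composition

/-! ### Necessity -/

section Necessity

variable {𝕜 : Type*} [RCLike 𝕜] {Λ : ℕ → ℝ}

theorem memLp_monomial {l : ℝ} (hl : 0 ≤ l) :
    MemLp (fun x : ℝ => ((x ^ l : ℝ) : 𝕜)) 1 unitMeasure :=
  memLp_one_iff_integrable.2 ((RCLike.continuous_ofReal.comp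
    (Real.continuous_rpow_const hl)).continuousOn.integrableOn_Icc)

theorem norm_toLp_monomial {l : ℝ} (hl : 0 ≤ l) :
    ‖(memLp_monomial (𝕜 := 𝕜) hl).toLp‖ = 1 / (l + 1) := by
  rw [L1.norm_eq_integral_norm]
  have h1 : ∫ x, ‖((memLp_monomial (𝕜 := 𝕜) hl).toLp : ℝ → 𝕜) x‖ ∂unitMeasure =
      ∫ x in Icc (0 : ℝ) 1, x ^ l := by
    refine (integral_congr_ae ((memLp_monomial (𝕜 := 𝕜) hl).coeFn_toLp.fun_comp norm)).trans
      (setIntegral_congr_fun measurableSet_Icc fun x hx => ?_)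
    simp [abs_of_nonneg (Real.rpow_nonneg hx.1 l)]
  rw [h1, integral_Icc_eq_integral_Ioc, ← intervalIntegral.integral_of_le zero_le_one,
    integral_rpow (Or.inl (by linarith)), Real.one_rpow, Real.zero_rpow (by linarith), sub_zero]

/-- The endpoint 1 is included because φ may equal 1 on a set of positive measure. -/
theorem IsContRepr.eqOn_monomial {l : ℝ} (hl : 0 ≤ l) {g : ℝ → 𝕜} {f : Lp 𝕜 1 unitMeasure}
    (hg : IsContRepr g f) (hf : ⇑f =ᵐ[unitMeasure] fun x => ((x ^ l : ℝ) : 𝕜)) :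
    EqOn g (fun x => ((x ^ l : ℝ) : 𝕜)) (Icc 0 1) := by
  have hc : Continuous fun x : ℝ => ((x ^ l : ℝ) : 𝕜) :=
    RCLike.continuous_ofReal.comp (Real.continuous_rpow_const hl)
  have h := eqOn_Ico_of_ae_eq_unitMeasure hg.continuousOn hc.continuousOn (hg.ae_eq.trans hf)
  intro x hx
  obtain rfl | hx1 := hx.2.eq_or_lt
  · refine hg.eq_of_tendsto _ (((hc.tendsto 1).mono_left nhdsWithin_le_nhds).congr' ?_)
    filter_upwards [Ioo_mem_nhdsLT (zero_lt_one' ℝ)] with x hx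
    exact (h ⟨hx.1.le, hx.2⟩).symm
  · exact h ⟨hx.1, hx1⟩

theorem exists_le_of_summable_one_div (hpos : ∀ n, 0 < Λ n) (hsum : Summable fun n => 1 / Λ n)
    {R : ℝ} (hR : 0 < R) : ∃ n, R < Λ n := by
  obtain ⟨n, hn⟩ := (hsum.tendsto_atTop_zero.eventually_lt_const (one_div_pos.2 hR)).exists
  exact ⟨n, (one_div_lt_one_div (hpos n) hR).1 hn⟩

theorem CompositionBounded.derivWithin_ne_zero (hpos : ∀ n, 0 < Λ n)
    (hsum : Summable fun n => 1 / Λ n) {φ : ℝ → ℝ} (hφ : ContDiffOn ℝ 1 φ (Icc 0 1))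
    (hmaps : MapsTo φ (Icc 0 1) (Icc 0 1)) (h : CompositionBounded 𝕜 Λ φ) {x₀ : ℝ}
    (hx₀ : x₀ ∈ Icc (0 : ℝ) 1) (hφx₀ : φ x₀ = 1) : derivWithin φ (Icc 0 1) x₀ ≠ 0 := by
  intro hd
  obtain ⟨T, hT⟩ := h
  have hTn : 0 ≤ ‖T‖ := norm_nonneg T
  -- Chosen so that the lower bound ℓ/2 = 1/(4εl) becomes (‖T‖ + 1)/l, which exceeds ‖T‖/(l + 1).
  set ε : ℝ := 1 / (4 * (‖T‖ + 1)) with hε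
  have hε0 : 0 < ε := by positivity
  have hder := (hφ.differentiableOn one_ne_zero x₀ hx₀).hasDerivWithinAt
  rw [hd] at hder
  obtain ⟨δ, hδ, hball⟩ := Metric.mem_nhdsWithin_iff.1 (hder.isLittleO.def hε0)
  -- The three summands give l ≥ 1 for Bernoulli's inequality, ℓ ≤ 1/2 so that an interval of length
  -- ℓ ending at x₀ fits in [0,1], and ℓ < δ.
  obtain ⟨n, hn⟩ := exists_le_of_summable_one_div hpos hsum
    (R := 1 + 1 / ε + 1 / (2 * ε * δ)) (by positivity)
  set l := Λ n with hl
  have hl0 : 0 < l := hpos n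
  have hl1 : 1 ≤ l := by
    have h1 : 0 < 1 / ε := by positivity
    have h2 : 0 < 1 / (2 * ε * δ) := by positivity
    linarith
  set ℓ : ℝ := 1 / (2 * ε * l) with hℓ
  have hℓ0 : 0 < ℓ := by positivity
  have hℓ2 : ℓ ≤ 1 / 2 := by
    have h1 : 1 / ε < l := by
      have h2 : 0 < 1 / (2 * ε * δ) := by positivity
      linarith
    rw [div_lt_iff₀ hε0] at h1
    rw [hℓ]
    exact one_div_le_one_div_of_le two_pos (by linarith)
  have hℓδ : ℓ < δ := by
    have h1 : 1 / (2 * ε * δ) < l := by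
      have h2 : 0 < 1 / ε := by positivity
      linarith
    rw [div_lt_iff₀ (by positivity)] at h1
    rw [hℓ, div_lt_iff₀ (by positivity)]
    linarith
  obtain ⟨a, ha, hxa⟩ : ∃ a, Icc a (a + ℓ) ⊆ Icc 0 1 ∧ x₀ ∈ Icc a (a + ℓ) := by
    rcases le_total x₀ (1 / 2) with hx | hx
    · exact ⟨x₀, Icc_subset_Icc hx₀.1 (by linarith), le_rfl, by linarith⟩
    · exact ⟨x₀ - ℓ, Icc_subset_Icc (by linarith) (by linarith [hx₀.2]), by linarith, by linarith⟩
  have hlow : ∀ x ∈ Icc a (a + ℓ), 1 / 2 ≤ φ x ^ l := by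
    intro x hx
    have hxx : |x - x₀| ≤ ℓ := by
      rw [abs_le]
      constructor <;> linarith [hx.1, hx.2, hxa.1, hxa.2]
    have h1 : ‖φ x - φ x₀ - (x - x₀) • (0 : ℝ)‖ ≤ ε * ‖x - x₀‖ :=
      hball ⟨by rw [Metric.mem_ball, Real.dist_eq]; linarith, ha hx⟩
    rw [smul_zero, sub_zero, hφx₀, Real.norm_eq_abs, Real.norm_eq_abs] at h1
    have h2 : ε * |x - x₀| ≤ ε * ℓ := by gcongr
    have h3 : ε * ℓ = 1 / (2 * l) := by rw [hℓ]; field_simp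
    have h4 : 1 + -(1 / (2 * l)) ≤ φ x := by linarith [neg_abs_le (φ x - 1)]
    have h5 : 1 / (2 * l) ≤ 1 := by
      rw [div_le_one (by positivity)]
      linarith
    calc (1 : ℝ) / 2 = 1 + l * -(1 / (2 * l)) := by field_simp; norm_num
      _ ≤ (1 + -(1 / (2 * l))) ^ l := one_add_mul_self_le_rpow_one_add (by linarith) hl1
      _ ≤ φ x ^ l := Real.rpow_le_rpow (by linarith) h4 hl0.le
  set p := (memLp_monomial (𝕜 := 𝕜) hl0.le).toLp with hp
  have hpM : p ∈ muntzSpace 𝕜 Λ := Submodule.le_topologicalClosure _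
    (Submodule.subset_span ⟨n, (memLp_monomial hl0.le).coeFn_toLp⟩)
  obtain ⟨g, hg, hTg⟩ := hT ⟨p, hpM⟩
  have hgp := hg.eqOn_monomial hl0.le (memLp_monomial hl0.le).coeFn_toLp
  have hnorm : ‖T ⟨p, hpM⟩‖ = ∫ x in Icc (0 : ℝ) 1, φ x ^ l := by
    rw [L1.norm_eq_integral_norm]
    refine (integral_congr_ae (hTg.fun_comp norm)).trans
      (setIntegral_congr_fun measurableSet_Icc fun x hx => ?_)
    simp only [Function.comp_apply, hgp (hmaps hx), RCLike.norm_ofReal]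
    exact abs_of_nonneg (Real.rpow_nonneg (hmaps hx).1 l)
  have hint : IntegrableOn (fun x => φ x ^ l) (Icc 0 1) :=
    (hφ.continuousOn.rpow_const fun _ _ => Or.inr hl0.le).integrableOn_Icc
  have hge : ℓ / 2 ≤ ∫ x in Icc (0 : ℝ) 1, φ x ^ l := by
    calc ℓ / 2 = ∫ x in Icc a (a + ℓ), (1 / 2 : ℝ) := by
          rw [setIntegral_const, Real.volume_real_Icc_of_le (by linarith), smul_eq_mul]
          ring
      _ ≤ ∫ x in Icc a (a + ℓ), φ x ^ l :=
          setIntegral_mono_on (by simp) (hint.mono_set ha) measurableSet_Icc hlow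
      _ ≤ _ := setIntegral_mono_set hint ((ae_restrict_iff' measurableSet_Icc).2
          (ae_of_all _ fun x hx => Real.rpow_nonneg (hmaps hx).1 l)) (LE.le.eventuallyLE ha)
  have hle : ‖T ⟨p, hpM⟩‖ ≤ ‖T‖ * (1 / (l + 1)) := by
    refine (T.le_opNorm _).trans_eq ?_
    rw [← norm_toLp_monomial (𝕜 := 𝕜) hl0.le]
    rfl
  have h1 : ℓ / 2 = (‖T‖ + 1) / l := by
    rw [hℓ, hε]
    field_simp
    norm_num
  have h2 : ‖T‖ * (1 / (l + 1)) ≤ ‖T‖ / l := by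
    rw [mul_one_div]
    gcongr
    linarith
  have h3 : (‖T‖ + 1) / l ≤ ‖T‖ / l := by linarith
  rw [div_le_div_iff_of_pos_right hl0] at h3
  linarith

theorem derivWithin_Icc_eq_zero_of_isMax {φ : ℝ → ℝ} (hmaps : MapsTo φ (Icc 0 1) (Icc 0 1)) {x₀ : ℝ}
    (hx₀ : x₀ ∈ Ioo (0 : ℝ) 1) (h : φ x₀ = 1) : derivWithin φ (Icc 0 1) x₀ = 0 := by
  have hn := Icc_mem_nhds hx₀.1 hx₀.2
  rw [derivWithin_of_mem_nhds hn]
  refine IsLocalMax.deriv_eq_zero ?_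
  filter_upwards [hn] with x hx
  rw [h]
  exact (hmaps hx).2

end Necessity

theorem mainTheorem10 (𝕜 : Type*) [RCLike 𝕜] (Λ : ℕ → ℝ) (hmono : StrictMono Λ)
    (hpos : ∀ n, 0 < Λ n) (hsum : Summable fun n => 1 / Λ n)
    (φ : ℝ → ℝ) (hφ : ContDiffOn ℝ 1 φ (Icc 0 1)) (hmaps : MapsTo φ (Icc 0 1) (Icc 0 1)) :
    CompositionBounded 𝕜 Λ φ ↔
      (φ '' Icc 0 1 ⊆ Ico 0 1 ∨
        (Icc 0 1 ∩ φ ⁻¹' {1} ⊆ {0, 1} ∧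
          ∀ x₀ ∈ Icc (0 : ℝ) 1, φ x₀ = 1 → derivWithin φ (Icc 0 1) x₀ ≠ 0)) := by
  constructor
  · intro h
    have hd : ∀ x₀ ∈ Icc (0 : ℝ) 1, φ x₀ = 1 → derivWithin φ (Icc 0 1) x₀ ≠ 0 :=
      fun x₀ hx₀ => h.derivWithin_ne_zero hpos hsum hφ hmaps hx₀
    -- The second alternative also covers the first, where it holds vacuously.
    refine Or.inr ⟨fun x hx => ?_, hd⟩
    by_contra hx'
    simp only [mem_insert_iff, mem_singleton_iff, not_or] at hx'
    exact hd x hx.1 hx.2 (derivWithin_Icc_eq_zero_of_isMax hmaps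
      ⟨lt_of_le_of_ne hx.1.1 (Ne.symm hx'.1), lt_of_le_of_ne hx.1.2 hx'.2⟩ hx.2)
  · rintro (h | ⟨h, hd⟩)
    · have hne : ∀ x ∈ Icc (0 : ℝ) 1, φ x ≠ 1 := fun x hx => (h ⟨x, hx, rfl⟩).2.ne
      refine compositionBounded_of_forall hmono hpos hsum hφ hmaps ?_
        fun x hx hx1 => absurd hx1 (hne x hx)
      have : Icc (0 : ℝ) 1 ∩ φ ⁻¹' {1} = ∅ := eq_empty_of_forall_notMem fun x hx => hne x hx.1 hx.2
      rw [this, measure_empty]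
    · exact compositionBounded_of_forall hmono hpos hsum hφ hmaps
        (measure_mono_null h (((finite_singleton 1).insert 0).measure_zero _)) hd
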